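/- For positive real numbers $a\ne b$ and real $r$, let $$L_r(a,b)=\Big(\frac{b^r-a^r}{r(b-a)}\Big)^{\frac1{r-1}}\quad(r\neq 0,1),\qquad C_r(a,b)=\Big(\frac{b^r+a^r}{b+a}\Big)^{\frac1{r-1}}\quad(r\neq 1)$$ be the generalized logarithmic mean and the generalized inverse harmonic mean, with the exceptional values defined as the corresponding limits, that is, $$L_0(a,b)=\frac{b-a}{\ln b-\ln a},\qquad L_1(a,b)=\frac1e\Big(\frac{b^b}{a^a}\Big)^{\frac1{b-a}},\qquad C_1(a,b)=\big(b^b a^a\big)^{\frac1{b+a}}.$$ Let $0<r<+\infty$ and $b>a>0$. Then (i) for every $\alpha\in(0,1]$, $\; C_r(a,b)^{\alpha}+C_{-r}(a,b)^{\alpha}>a^{\alpha}+b^{\alpha}$; (ii) for every $\beta\in[0,+\infty)$, $\; C_r(a,b)^{2+\beta}+C_{-r}(a,b)^{2+\beta}<a^{2+\beta}+b^{2+\beta}$; (iii) for every $\beta\in[0,+\infty)$, $\; L_r(a,b)^{1+\beta}+L_{-r}(a,b)^{1+\beta}<a^{1+\beta}+b^{1+\beta}$. -/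

import Mathlib

noncomputable section

/-- The generalized logarithmic mean `L_r(a, b)` of two positive numbers `a`, `b`, for real `r`:
`((b ^ r - a ^ r) / (r * (b - a))) ^ (1 / (r - 1))`, where the removable singularities at
`r = 0`, `r = 1` and `a = b` are filled in by the corresponding limits. -/
def genLogMean (r a b : ℝ) : ℝ :=
  if a = b then a
  else if r = 0 then (b - a) / (Real.log b - Real.log a)
  else if r = 1 then (1 / Real.exp 1) * (b ^ b / a ^ a) ^ (1 / (b - a))
  else ((b ^ r - a ^ r) / (r * (b - a))) ^ (1 / (r - 1))

/-- The generalized inverse harmonic mean `C_r(a, b)` of two positive numbers `a`, `b`, for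
real `r`: `((b ^ r + a ^ r) / (b + a)) ^ (1 / (r - 1))`, where the removable singularity at
`r = 1` is filled in by the corresponding limit. -/
def genInvHarmMean (r a b : ℝ) : ℝ :=
  if r = 1 then (b ^ b * a ^ a) ^ (1 / (b + a))
  else ((b ^ r + a ^ r) / (b + a)) ^ (1 / (r - 1))

end

/-!
Write `a = exp (g - u)`, `b = exp (g + u)`, `V x = log (2 * cosh x)` and `F x = log (sinh x / x)`.
Then `log C_r = g + u * s`, where `s` is the slope of `V` between `u` and `r * u`; for `L_r` the
same holds with `F` in place of `V`. As `V` and `F` are even, both slopes for `r` and `-r` come from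
the slope `D` in the squared variable between `u ^ 2` and `(r * u) ^ 2`: the logarithms of the two
means are `g + k ± w` with `k = u ^ 2 * D` and `w = r * u ^ 2 * D`. So the two means add up to
`exp (g + k + V w)`, while `a + b = exp (g + V u)`.

Cauchy's mean value theorem shows that `f u - k < f w` when `x ^ 2 - f x ^ 2` is a strictly concave
function of `f x`, and `f w ≤ f u - k` when it is a convex one. The first case applies to `V` and
says `a + b < C_r + C_{-r}`. The second applies to `F`, and since `V - F` is increasing it gives
`L_r + L_{-r} < a + b`. The bound `C_r ^ 2 + C_{-r} ^ 2 < a ^ 2 + b ^ 2` reads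
`V (2 * w) + 2 * k < V (2 * u)` and rests on the same concavity for `V`. All other exponents follow
from Karamata's inequality for two points.
-/

open Real Set

/-! ### Monotonicity on the positive half-line -/

section HalfLine

variable {f f' : ℝ → ℝ}

theorem strictMonoOn_Ioi_of_hasDerivAt_pos (hf : ∀ x, 0 < x → HasDerivAt f (f' x) x)
    (hpos : ∀ x, 0 < x → 0 < f' x) : StrictMonoOn f (Ioi 0) := by
  refine strictMonoOn_of_deriv_pos (convex_Ioi 0)
    (fun x hx => (hf x hx).continuousAt.continuousWithinAt) fun x hx => ?_
  rw [interior_Ioi] at hx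
  exact (hf x hx).deriv ▸ hpos x hx

theorem monotoneOn_Ioi_of_hasDerivAt_nonneg (hf : ∀ x, 0 < x → HasDerivAt f (f' x) x)
    (hnonneg : ∀ x, 0 < x → 0 ≤ f' x) : MonotoneOn f (Ioi 0) := by
  refine monotoneOn_of_hasDerivWithinAt_nonneg (f' := f') (convex_Ioi 0)
    (fun x hx => (hf x hx).continuousAt.continuousWithinAt) ?_ ?_ <;> rw [interior_Ioi]
  · exact fun x hx => (hf x hx).hasDerivWithinAt
  · exact hnonneg

theorem pos_of_hasDerivAt_pos (hf : ∀ x, HasDerivAt f (f' x) x) (h0 : f 0 = 0)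
    (hpos : ∀ x, 0 < x → 0 < f' x) {x : ℝ} (hx : 0 < x) : 0 < f x := by
  have hmono : StrictMonoOn f (Ici 0) := by
    refine strictMonoOn_of_deriv_pos (convex_Ici 0)
      (fun x _ => (hf x).continuousAt.continuousWithinAt) fun x hx => ?_
    rw [interior_Ici] at hx
    exact (hf x).deriv ▸ hpos x hx
  exact h0 ▸ hmono self_mem_Ici hx.le hx

theorem nonneg_of_monotoneOn_of_le_of_tendsto {f g : ℝ → ℝ} (hf : MonotoneOn f (Ioi 0))
    (hgf : ∀ x, 0 < x → g x ≤ f x) (hg : Filter.Tendsto g (nhdsWithin 0 (Ioi 0)) (nhds 0))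
    {x : ℝ} (hx : 0 < x) : 0 ≤ f x := by
  refine le_of_tendsto hg ?_
  filter_upwards [Ioo_mem_nhdsGT hx] with y hy
  exact (hgf y hy.1).trans (hf hy.1 hx hy.2.le)

end HalfLine

/-! ### Slopes in the squared argument -/

/-- The slope of `f`, as a function of the square of its argument, between `u ^ 2` and `v ^ 2`.
Using `dslope` includes the tangent case `u = v`. -/
noncomputable def sqDslope (f : ℝ → ℝ) (u v : ℝ) : ℝ := dslope f u v / (u + v)

/-- The value at `0` of the secant line of `f`, as a function of the square of its argument, through
the points with arguments `u` and `v`. -/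
noncomputable def sqIntercept (f : ℝ → ℝ) (u v : ℝ) : ℝ := f u - u ^ 2 * sqDslope f u v

/-- The derivative of `x ^ 2 - f x ^ 2` with respect to `f x`; it is monotone when
`x ^ 2 - f x ^ 2` is a convex function of `f x`, and antitone when it is a concave one. -/
noncomputable def sqGapSlope (f : ℝ → ℝ) (x : ℝ) : ℝ := 2 * x / deriv f x - 2 * f x

section SqDslope

variable {f : ℝ → ℝ} {u v : ℝ}

theorem sqDslope_comm (f : ℝ → ℝ) (u v : ℝ) : sqDslope f u v = sqDslope f v u := by
  obtain rfl | h := eq_or_ne u v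
  · rfl
  · rw [sqDslope, sqDslope, dslope_of_ne f h, dslope_of_ne f h.symm, slope_comm, add_comm]

theorem dslope_eq_sqDslope_mul (h : u + v ≠ 0) : dslope f u v = sqDslope f u v * (u + v) :=
  (div_mul_cancel₀ _ h).symm

theorem sqDslope_mul_sq_sub_sq (h : u + v ≠ 0) : sqDslope f u v * (v ^ 2 - u ^ 2) = f v - f u := by
  rw [← sub_smul_dslope f u v, dslope_eq_sqDslope_mul h, smul_eq_mul]
  ring

theorem sqIntercept_comm (h : u + v ≠ 0) : sqIntercept f u v = sqIntercept f v u := by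
  rw [sqIntercept, sqIntercept, sqDslope_comm f v u]
  linear_combination sqDslope_mul_sq_sub_sq (f := f) h

theorem dslope_neg_eq_sqDslope_mul (hf : Function.Even f) (hu : 0 < u) (hv : 0 < v) :
    dslope f u (-v) = sqDslope f u v * (u - v) := by
  have hsum : u + v ≠ 0 := by positivity
  have hslope : (-v - u) * dslope f u (-v) = f v - f u := by
    rw [← hf v, ← smul_eq_mul, sub_smul_dslope]
  refine mul_left_cancel₀ (neg_ne_zero.2 hsum) ?_
  linear_combination hslope - sqDslope_mul_sq_sub_sq (f := f) hsum

theorem exists_sqDslope_mul_add_eq_deriv (hf : DifferentiableOn ℝ f (Ioi 0)) (hu : 0 < u)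
    (hv : 0 < v) : ∃ ξ, 0 < ξ ∧ sqDslope f u v * (u + v) = deriv f ξ := by
  wlog huv : u ≤ v generalizing u v
  · simpa only [sqDslope_comm, add_comm] using this hv hu (le_of_not_ge huv)
  rw [← dslope_eq_sqDslope_mul (by positivity)]
  obtain rfl | hlt := huv.eq_or_lt
  · exact ⟨u, hu, dslope_same f u⟩
  · obtain ⟨ξ, hξ, h⟩ := exists_deriv_eq_slope' f hlt
      (hf.continuousOn.mono fun x hx => hu.trans_le hx.1) (hf.mono fun x hx => hu.trans hx.1)
    exact ⟨ξ, hu.trans hξ.1, by rw [dslope_of_ne f hlt.ne', h]⟩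

theorem exists_sq_sub_sq_eq_mul_sqGapSlope (hpos : ∀ x, 0 < x → 0 < deriv f x) (hu : 0 < u)
    (huv : u < v) :
    ∃ ξ ∈ Ioo u v, v ^ 2 - u ^ 2 = (f v - f u) * (sqGapSlope f ξ + f u + f v) := by
  have hf : ∀ x, 0 < x → DifferentiableAt ℝ f x := fun x hx =>
    differentiableAt_of_deriv_ne_zero (hpos x hx).ne'
  obtain ⟨ξ, hξ, h⟩ := exists_ratio_hasDerivAt_eq_ratio_slope f (deriv f) huv
    (fun x hx => (hf x (hu.trans_le hx.1)).continuousAt.continuousWithinAt)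
    (fun x hx => (hf x (hu.trans hx.1)).hasDerivAt) (fun x => x ^ 2 - f x ^ 2)
    (fun x => 2 * x - 2 * f x * deriv f x)
    (fun x hx => ((continuous_pow 2).continuousAt.sub
      ((hf x (hu.trans_le hx.1)).continuousAt.pow 2)).continuousWithinAt)
    (fun x hx => ((hasDerivAt_pow 2 x).sub
      ((hf x (hu.trans hx.1)).hasDerivAt.pow 2)).congr_deriv (by norm_num))
  have hne := (hpos ξ (hu.trans hξ.1)).ne'
  refine ⟨ξ, hξ, mul_right_cancel₀ hne ?_⟩
  have hslope : sqGapSlope f ξ * deriv f ξ = 2 * ξ - 2 * f ξ * deriv f ξ := by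
    rw [sqGapSlope, sub_mul, div_mul_cancel₀ _ hne]
  linear_combination h - (f v - f u) * hslope

theorem exists_sqDslope_mul_sqGapSlope_eq_one (hpos : ∀ x, 0 < x → 0 < deriv f x) (hu : 0 < u)
    (huv : u ≤ v) : ∃ ζ, u ≤ ζ ∧ sqDslope f u v * (sqGapSlope f ζ + f u + f v) = 1 := by
  obtain rfl | hlt := huv.eq_or_lt
  · have hne := (hpos u hu).ne'
    refine ⟨u, le_rfl, ?_⟩
    rw [sqDslope, sqGapSlope, dslope_same]
    field_simp
    ring
  · obtain ⟨ζ, hζ, h⟩ := exists_sq_sub_sq_eq_mul_sqGapSlope hpos hu hlt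
    have hsq : v ^ 2 - u ^ 2 ≠ 0 := by nlinarith
    refine ⟨ζ, hζ.1.le, mul_right_cancel₀ hsq ?_⟩
    rw [mul_right_comm, sqDslope_mul_sq_sub_sq (by linarith), ← h, one_mul]

theorem differentiableOn_Ioi_of_deriv_pos (hpos : ∀ x, 0 < x → 0 < deriv f x) :
    DifferentiableOn ℝ f (Ioi 0) := fun x hx =>
  (differentiableAt_of_deriv_ne_zero (hpos x hx).ne').differentiableWithinAt

theorem strictMonoOn_Ioi_of_deriv_pos (hpos : ∀ x, 0 < x → 0 < deriv f x) :
    StrictMonoOn f (Ioi 0) :=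
  strictMonoOn_Ioi_of_hasDerivAt_pos
    (fun x hx => (differentiableAt_of_deriv_ne_zero (hpos x hx).ne').hasDerivAt) hpos

theorem sq_sub_sq_slope_lt_of_strictAntiOn {x y z : ℝ} (hpos : ∀ x, 0 < x → 0 < deriv f x)
    (hanti : StrictAntiOn (sqGapSlope f) (Ioi 0)) (hx : 0 < x) (hxy : x < y) (hyz : y < z) :
    ((z ^ 2 - f z ^ 2) - (y ^ 2 - f y ^ 2)) * (f y - f x) <
      ((y ^ 2 - f y ^ 2) - (x ^ 2 - f x ^ 2)) * (f z - f y) := by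
  obtain ⟨ξ, hξ, hξ_eq⟩ := exists_sq_sub_sq_eq_mul_sqGapSlope hpos hx hxy
  obtain ⟨ζ, hζ, hζ_eq⟩ := exists_sq_sub_sq_eq_mul_sqGapSlope hpos (hx.trans hxy) hyz
  have hgap : sqGapSlope f ζ < sqGapSlope f ξ :=
    hanti (hx.trans hξ.1) (hx.trans (hxy.trans hζ.1)) (hξ.2.trans hζ.1)
  have hf := strictMonoOn_Ioi_of_deriv_pos hpos
  have hfxy := sub_pos.2 (hf hx (hx.trans hxy) hxy)
  have hfyz := sub_pos.2 (hf (hx.trans hxy) (hx.trans (hxy.trans hyz)) hyz)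
  linear_combination (f y - f x) * hζ_eq - (f z - f y) * hξ_eq +
    (f y - f x) * (f z - f y) * hgap

section Bounds

variable (hpos : ∀ x, 0 < x → 0 < deriv f x) (hlt : ∀ x, 0 < x → deriv f x < 1)

include hpos

theorem sqDslope_pos (hu : 0 < u) (hv : 0 < v) : 0 < sqDslope f u v := by
  obtain ⟨ξ, hξ, h⟩ :=
    exists_sqDslope_mul_add_eq_deriv (differentiableOn_Ioi_of_deriv_pos hpos) hu hv
  exact pos_of_mul_pos_left (h ▸ hpos ξ hξ) (by positivity)

include hlt

theorem sqDslope_mul_add_lt_one (hu : 0 < u) (hv : 0 < v) : sqDslope f u v * (u + v) < 1 := by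
  obtain ⟨ξ, hξ, h⟩ :=
    exists_sqDslope_mul_add_eq_deriv (differentiableOn_Ioi_of_deriv_pos hpos) hu hv
  exact h ▸ hlt ξ hξ

theorem mul_mul_sqDslope_lt (hu : 0 < u) (hv : 0 < v) : u * v * sqDslope f u v < u := by
  have hD := sqDslope_pos hpos hu hv
  have hsum := sqDslope_mul_add_lt_one hpos hlt hu hv
  rw [mul_assoc]
  exact mul_lt_of_lt_one_right hu (by nlinarith [mul_pos hD hu])

theorem sub_mem_Ioo_of_deriv_mem_Ioo (hu : 0 < u) (huv : u < v) : f v - f u ∈ Ioo 0 (v - u) := by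
  have hf := differentiableOn_Ioi_of_deriv_pos hpos
  refine ⟨sub_pos.2 (strictMonoOn_Ioi_of_deriv_pos hpos hu (hu.trans huv) huv), ?_⟩
  have h := (convex_Ioi (0 : ℝ)).image_sub_lt_mul_sub_of_deriv_lt hf.continuousOn
    (hf.mono interior_subset) (C := 1) (by rw [interior_Ioi]; exact hlt) u hu v (hu.trans huv) huv
  rwa [one_mul] at h

-- Cauchy's mean value theorem for `x ^ 2 - f x ^ 2` against `f`, on `[u * v * sqDslope f u v, u]`
-- and on `[u, v]`.
theorem exists_pos_sub_sqIntercept_mul_eq (hu : 0 < u) (huv : u ≤ v) :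
    ∃ ξ ζ c, 0 < ξ ∧ ξ < ζ ∧ 0 < c ∧
      (f (u * v * sqDslope f u v) - sqIntercept f u v) * c =
        sqGapSlope f ξ - sqGapSlope f ζ := by
  have hv : 0 < v := hu.trans_le huv
  have hD := sqDslope_pos hpos hu hv
  have hsum := sqDslope_mul_add_lt_one hpos hlt hu hv
  have hwu := mul_mul_sqDslope_lt hpos hlt hu hv
  have hchord := sqDslope_mul_sq_sub_sq (f := f) (add_pos hu hv).ne'
  obtain ⟨ζ, hζ, hζ_eq⟩ := exists_sqDslope_mul_sqGapSlope_eq_one hpos hu huv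
  rw [sqIntercept]
  set D := sqDslope f u v
  have hw : 0 < u * v * D := by positivity
  obtain ⟨ξ, hξ, hξ_eq⟩ := exists_sq_sub_sq_eq_mul_sqGapSlope hpos hw hwu
  obtain ⟨hδ, hδ_lt⟩ := sub_mem_Ioo_of_deriv_mem_Ioo hpos hlt hw hwu
  set δ := f u - f (u * v * D)
  have hfactor : 0 < 1 - (D * v) ^ 2 - D * δ := by
    have hDδ : D * δ < D * u * (1 - D * v) := by nlinarith
    nlinarith [mul_pos hD hv]
  refine ⟨ξ, ζ, (1 - (D * v) ^ 2 - D * δ) / (δ * D), hw.trans hξ.1, hξ.2.trans_le hζ,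
    by positivity, ?_⟩
  rw [mul_div_assoc', div_eq_iff (by positivity)]
  linear_combination D * hξ_eq + δ * hζ_eq + D * δ * hchord

theorem sqIntercept_lt_of_strictAntiOn (hanti : StrictAntiOn (sqGapSlope f) (Ioi 0)) (hu : 0 < u)
    (hv : 0 < v) : sqIntercept f u v < f (u * v * sqDslope f u v) := by
  wlog huv : u ≤ v generalizing u v
  · rw [sqIntercept_comm (by positivity), mul_comm u v, sqDslope_comm f u v]
    exact this hv hu (le_of_not_ge huv)
  obtain ⟨ξ, ζ, c, hξ, hξζ, hc, h⟩ := exists_pos_sub_sqIntercept_mul_eq hpos hlt hu huv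
  exact sub_pos.1 <| pos_of_mul_pos_left (h ▸ sub_pos.2 (hanti hξ (hξ.trans hξζ) hξζ)) hc.le

theorem le_sqIntercept_of_monotoneOn (hmono : MonotoneOn (sqGapSlope f) (Ioi 0)) (hu : 0 < u)
    (hv : 0 < v) : f (u * v * sqDslope f u v) ≤ sqIntercept f u v := by
  wlog huv : u ≤ v generalizing u v
  · rw [sqIntercept_comm (by positivity), mul_comm u v, sqDslope_comm f u v]
    exact this hv hu (le_of_not_ge huv)
  obtain ⟨ξ, ζ, c, hξ, hξζ, hc, h⟩ := exists_pos_sub_sqIntercept_mul_eq hpos hlt hu huv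
  have hgap := hmono hξ (hξ.trans hξζ) hξζ.le
  exact sub_nonpos.1 <| nonpos_of_mul_nonpos_left (h ▸ sub_nonpos.2 hgap) hc

end Bounds

end SqDslope

/-! ### Sums of powers -/

theorem map_add_map_le_of_convexOn {f : ℝ → ℝ} {s : Set ℝ} {a b x : ℝ} (hf : ConvexOn ℝ s f)
    (ha : a ∈ s) (hb : b ∈ s) (hx : x ∈ Icc a b) : f x + f (a + b - x) ≤ f a + f b := by
  obtain ⟨p, q, hp, hq, hpq, rfl⟩ : x ∈ segment ℝ a b :=
    segment_eq_Icc (hx.1.trans hx.2) ▸ hx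
  have hswap : a + b - (p • a + q • b) = q • a + p • b := by
    simp only [smul_eq_mul]
    linear_combination (-a - b) * hpq
  calc f (p • a + q • b) + f (a + b - (p • a + q • b))
      ≤ (p • f a + q • f b) + (q • f a + p • f b) := by
        rw [hswap]
        exact add_le_add (hf.2 ha hb hp hq hpq) (hf.2 ha hb hq hp (add_comm p q ▸ hpq))
    _ = f a + f b := by
        simp only [smul_eq_mul]
        linear_combination (f a + f b) * hpq

theorem rpow_add_rpow_lt_of_le_one {a b x y α : ℝ} (ha : 0 ≤ a) (hx : x ∈ Icc a b)
    (hα : 0 < α) (hα_one : α ≤ 1) (h : a + b < x + y) : a ^ α + b ^ α < x ^ α + y ^ α := by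
  have hb : 0 ≤ b := ha.trans (hx.1.trans hx.2)
  have hconc := map_add_map_le_of_convexOn (concaveOn_rpow hα.le hα_one).neg ha hb hx
  have hy : (a + b - x) ^ α < y ^ α := rpow_lt_rpow (by linarith [hx.2]) (by linarith) hα
  simp only [Pi.neg_apply] at hconc
  linarith

theorem rpow_add_rpow_lt_of_rpow_add_rpow_lt {a b x y p q : ℝ} (ha : 0 ≤ a) (hy : 0 ≤ y)
    (hx : x ∈ Icc a b) (hp : 0 < p) (hpq : p ≤ q)
    (h : x ^ p + y ^ p < a ^ p + b ^ p) : x ^ q + y ^ q < a ^ q + b ^ q := by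
  have hx_nonneg : 0 ≤ x := ha.trans hx.1
  have hb : 0 ≤ b := hx_nonneg.trans hx.2
  have hxp : x ^ p ∈ Icc (a ^ p) (b ^ p) :=
    ⟨rpow_le_rpow ha hx.1 hp.le, rpow_le_rpow hx_nonneg hx.2 hp.le⟩
  have hconv := map_add_map_le_of_convexOn (convexOn_rpow ((one_le_div hp).2 hpq))
    (rpow_nonneg ha p) (rpow_nonneg hb p) hxp
  have hy_lt : (y ^ p) ^ (q / p) < (a ^ p + b ^ p - x ^ p) ^ (q / p) :=
    rpow_lt_rpow (rpow_nonneg hy p) (by linarith) (div_pos (hp.trans_le hpq) hp)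
  have hpow : ∀ z : ℝ, 0 ≤ z → (z ^ p) ^ (q / p) = z ^ q := fun z hz => by
    rw [← rpow_mul hz, mul_div_cancel₀ _ hp.ne']
  rw [hpow y hy] at hy_lt
  rw [hpow x hx_nonneg, hpow a ha, hpow b hb] at hconv
  linarith

/-! ### The function `log (2 * cosh x)` -/

theorem hasDerivAt_tanh (x : ℝ) : HasDerivAt tanh (1 - tanh x ^ 2) x := by
  have hc := (cosh_pos x).ne'
  rw [show tanh = fun y => sinh y / cosh y from funext tanh_eq_sinh_div_cosh]
  refine ((hasDerivAt_sinh x).div (hasDerivAt_cosh x) hc).congr_deriv ?_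
  field_simp

theorem tanh_pos_of_pos {x : ℝ} (hx : 0 < x) : 0 < tanh x := by
  rw [tanh_eq_sinh_div_cosh]
  exact div_pos (sinh_pos_iff.2 hx) (cosh_pos x)

theorem tanh_lt_self {x : ℝ} (hx : 0 < x) : tanh x < x := by
  refine sub_pos.1 (pos_of_hasDerivAt_pos (f := fun y => y - tanh y)
    (fun y => (hasDerivAt_id y).sub (hasDerivAt_tanh y)) (by simp) (fun y hy => ?_) hx)
  nlinarith [tanh_pos_of_pos hy]

theorem strictMono_tanh : StrictMono tanh :=
  strictMono_of_hasDerivAt_pos hasDerivAt_tanh fun x => by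
    nlinarith [tanh_lt_one x, neg_one_lt_tanh x]

/-- The logarithm of `2 * cosh x = exp x + exp (-x)`. -/
noncomputable def logTwoCosh (x : ℝ) : ℝ := log (2 * cosh x)

theorem exp_logTwoCosh (x : ℝ) : exp (logTwoCosh x) = 2 * cosh x :=
  exp_log (by positivity)

theorem even_logTwoCosh : Function.Even logTwoCosh := fun x => by
  rw [logTwoCosh, logTwoCosh, cosh_neg]

theorem hasDerivAt_logTwoCosh (x : ℝ) : HasDerivAt logTwoCosh (tanh x) x := by
  refine (((hasDerivAt_cosh x).const_mul 2).log (by positivity)).congr_deriv ?_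
  rw [tanh_eq_sinh_div_cosh, mul_div_mul_left _ _ two_ne_zero]

theorem deriv_logTwoCosh : deriv logTwoCosh = tanh := funext fun x =>
  (hasDerivAt_logTwoCosh x).deriv

theorem deriv_logTwoCosh_pos (x : ℝ) (hx : 0 < x) : 0 < deriv logTwoCosh x :=
  deriv_logTwoCosh ▸ tanh_pos_of_pos hx

theorem deriv_logTwoCosh_lt_one (x : ℝ) : deriv logTwoCosh x < 1 :=
  deriv_logTwoCosh ▸ tanh_lt_one x

theorem strictMonoOn_logTwoCosh : StrictMonoOn logTwoCosh (Ioi 0) :=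
  strictMonoOn_Ioi_of_deriv_pos deriv_logTwoCosh_pos

theorem strictAntiOn_sqGapSlope_logTwoCosh : StrictAntiOn (sqGapSlope logTwoCosh) (Ioi 0) := by
  have hderiv : ∀ x, 0 < x → HasDerivAt (fun y => -sqGapSlope logTwoCosh y)
      (2 * (1 - tanh x ^ 2) * (x - tanh x) / tanh x ^ 2) x := fun x hx => by
    have ht := (tanh_pos_of_pos hx).ne'
    simp only [sqGapSlope, deriv_logTwoCosh]
    refine (((((hasDerivAt_id' x).const_mul 2).div (hasDerivAt_tanh x) ht).sub
      ((hasDerivAt_logTwoCosh x).const_mul 2)).neg).congr_deriv ?_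
    field_simp
    ring
  refine fun x hx y hy hxy => neg_lt_neg_iff.1 <|
    strictMonoOn_Ioi_of_hasDerivAt_pos hderiv (fun z hz => ?_) hx hy hxy
  have ht := tanh_pos_of_pos hz
  have hone : 0 < 1 - tanh z ^ 2 := by nlinarith [tanh_lt_one z]
  have hself := sub_pos.2 (tanh_lt_self hz)
  positivity

theorem exp_logTwoCosh_add_self (x : ℝ) : exp (logTwoCosh x + x) = exp (2 * x) + 1 := by
  rw [exp_add, exp_logTwoCosh, cosh_eq, two_mul x, exp_add]
  have h : exp (-x) * exp x = 1 := by rw [← exp_add, neg_add_cancel, exp_zero]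
  linear_combination h

theorem logTwoCosh_eq_self_add (x : ℝ) : logTwoCosh x = x + log (1 + exp (-(2 * x))) := by
  have h : exp (-x) = exp x * exp (-(2 * x)) := by rw [← exp_add]; ring_nf
  rw [logTwoCosh, ← log_exp x, ← log_mul (by positivity) (by positivity), log_exp, cosh_eq, h]
  ring_nf

theorem self_lt_logTwoCosh (x : ℝ) : x < logTwoCosh x := by
  rw [logTwoCosh_eq_self_add, lt_add_iff_pos_right]
  exact log_pos (lt_add_of_pos_right 1 (exp_pos _))

theorem tanh_eq_one_sub_exp_div (x : ℝ) :
    tanh x = (1 - exp (-(2 * x))) / (1 + exp (-(2 * x))) := by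
  have h : exp (-x) = exp x * exp (-(2 * x)) := by rw [← exp_add]; ring_nf
  rw [tanh_eq, h, ← mul_one_sub, ← mul_one_add, mul_div_mul_left _ _ (exp_pos x).ne']

theorem logTwoCosh_mul_tanh_lt {x : ℝ} (hx : 0 < x) : logTwoCosh x * tanh x < x := by
  rw [logTwoCosh_eq_self_add, tanh_eq_one_sub_exp_div]
  set y := exp (-(2 * x))
  have hy : 0 < y := exp_pos _
  have hy_one : y < 1 := exp_lt_one_iff.2 (by linarith)
  have hlog : log (1 + y) ≤ y := by linarith [log_le_sub_one_of_pos (by positivity : 0 < 1 + y)]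
  have hexp : 1 - y < 2 * x := by
    linarith [add_one_lt_exp (show -(2 * x) ≠ 0 by linarith)]
  rw [← mul_div_assoc, div_lt_iff₀ (by positivity)]
  nlinarith [mul_le_mul_of_nonneg_right hlog (sub_nonneg.2 hy_one.le)]

theorem sqGapSlope_logTwoCosh_pos {x : ℝ} (hx : 0 < x) : 0 < sqGapSlope logTwoCosh x := by
  rw [sqGapSlope, deriv_logTwoCosh, mul_div_assoc, ← mul_sub]
  exact mul_pos two_pos
    (sub_pos.2 ((lt_div_iff₀ (tanh_pos_of_pos hx)).2 (logTwoCosh_mul_tanh_lt hx)))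

theorem sqDslope_logTwoCosh_mul_add_lt_one {u v : ℝ} (hu : 0 < u) (huv : u ≤ v) :
    sqDslope logTwoCosh u v * (logTwoCosh u + logTwoCosh v) < 1 := by
  obtain ⟨ζ, hζ, h⟩ := exists_sqDslope_mul_sqGapSlope_eq_one deriv_logTwoCosh_pos hu huv
  have hD := sqDslope_pos deriv_logTwoCosh_pos hu (hu.trans_le huv)
  nlinarith [mul_pos hD (sqGapSlope_logTwoCosh_pos (hu.trans_le hζ))]

theorem monotoneOn_logTwoCosh_two_mul_sub :
    MonotoneOn (fun x => logTwoCosh (2 * x) - 2 * logTwoCosh x) (Ioi 0) := by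
  refine monotoneOn_Ioi_of_hasDerivAt_nonneg (f' := fun x => 2 * tanh (2 * x) - 2 * tanh x)
    (fun x _ => ?_) fun x hx => ?_
  · refine (((hasDerivAt_logTwoCosh (2 * x)).comp x ((hasDerivAt_id' x).const_mul 2)).sub
      ((hasDerivAt_logTwoCosh x).const_mul 2)).congr_deriv ?_
    ring
  · linarith [strictMono_tanh (show x < 2 * x by linarith)]

theorem exp_logTwoCosh_three_mul_sub (u : ℝ) :
    exp (logTwoCosh (3 * u) - logTwoCosh u) = 2 * cosh (2 * u) - 1 := by
  rw [exp_sub, exp_logTwoCosh, exp_logTwoCosh, div_eq_iff (by positivity), cosh_three_mul,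
    cosh_two_mul, sinh_sq]
  ring

-- Half of `logTwoCosh (3 * u) - logTwoCosh u` solves `logTwoCosh x + x = logTwoCosh (2 * u)`, so a
-- quarter of it is the value of `k = w` giving equality in `logTwoCosh_two_mul_add_lt`.
theorem logTwoCosh_half_three_mul_sub (u : ℝ) :
    logTwoCosh ((logTwoCosh (3 * u) - logTwoCosh u) / 2) =
      logTwoCosh (2 * u) - (logTwoCosh (3 * u) - logTwoCosh u) / 2 := by
  refine eq_sub_of_add_eq (exp_injective ?_)
  rw [exp_logTwoCosh_add_self, mul_div_cancel₀ _ two_ne_zero, exp_logTwoCosh_three_mul_sub,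
    exp_logTwoCosh, sub_add_cancel]

theorem three_mul_sq_le_logTwoCosh_sub {u : ℝ} (hu : 0 < u) (hu' : u ≤ 2 / 5) :
    3 * u ^ 2 ≤ logTwoCosh (3 * u) - logTwoCosh u := by
  have hcosh : 1 + 4 * u ^ 2 ≤ 2 * cosh (2 * u) - 1 := by
    nlinarith [cosh_two_mul u, cosh_sq u, self_le_sinh_iff.2 hu.le]
  calc 3 * u ^ 2 ≤ 2 * (4 * u ^ 2) / (4 * u ^ 2 + 2) := by
        rw [le_div_iff₀ (by positivity)]
        nlinarith [mul_pos hu hu, mul_le_mul hu' hu' hu.le (by norm_num)]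
    _ ≤ log (1 + 4 * u ^ 2) := le_log_one_add_of_nonneg (by positivity)
    _ ≤ log (2 * cosh (2 * u) - 1) := log_le_log (by positivity) hcosh
    _ = logTwoCosh (3 * u) - logTwoCosh u := by rw [← exp_logTwoCosh_three_mul_sub, log_exp]

theorem logTwoCosh_le_two_mul {u : ℝ} (hu : 2 / 5 ≤ u) : logTwoCosh u ≤ 2 * u := by
  have hz := quadratic_le_exp_of_nonneg (show 0 ≤ u by linarith)
  set z := exp u with hz_def
  have hz' : 148 / 100 ≤ z := by nlinarith
  have hexp : exp (logTwoCosh u + u) ≤ exp (2 * u + u) := by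
    rw [exp_logTwoCosh_add_self, exp_add, two_mul, exp_add, ← hz_def]
    nlinarith [mul_nonneg (sub_nonneg.2 hz') (sub_nonneg.2 hz'),
      mul_nonneg (mul_nonneg (sub_nonneg.2 hz') (sub_nonneg.2 hz')) (sub_nonneg.2 hz')]
  linarith [exp_le_exp.1 hexp]

theorem two_mul_sq_lt_logTwoCosh_mul {u : ℝ} (hu : 0 < u) :
    2 * u ^ 2 < logTwoCosh u * (logTwoCosh (3 * u) - logTwoCosh u) := by
  have husq : 0 < u ^ 2 := by positivity
  rcases le_total u (2 / 5) with hle | hge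
  · have hlog : 2 / 3 < logTwoCosh u := by
      refine lt_of_lt_of_le (by linarith [log_two_gt_d9]) (log_le_log two_pos ?_)
      linarith [one_le_cosh u]
    nlinarith [three_mul_sq_le_logTwoCosh_sub hu hle]
  · -- If `logTwoCosh u = u + e`, then `0 < e ≤ u` and
    -- `(u + e) * (2 * u - e) = 2 * u ^ 2 + e * (u - e)`.
    have hlt := self_lt_logTwoCosh u
    have hle := logTwoCosh_le_two_mul hge
    have h3 := self_lt_logTwoCosh (3 * u)
    nlinarith [mul_nonneg (sub_nonneg.2 hlt.le) (sub_nonneg.2 hle),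
      mul_pos (hu.trans hlt) (sub_pos.2 h3)]

theorem four_mul_sq_sub_sq_lt_logTwoCosh_sub_mul {u w : ℝ} (hu : 0 < u)
    (hw : (logTwoCosh (3 * u) - logTwoCosh u) / 4 < w) (hwu : w < u) :
    4 * (u ^ 2 - w ^ 2) < (logTwoCosh (2 * u) - logTwoCosh (2 * w)) *
      (4 * logTwoCosh u - (logTwoCosh (2 * u) - logTwoCosh (2 * w))) := by
  have hlower := two_mul_sq_lt_logTwoCosh_mul hu
  have hq_eq := logTwoCosh_half_three_mul_sub u
  obtain ⟨q, hq⟩ : ∃ q, q = (logTwoCosh (3 * u) - logTwoCosh u) / 4 := ⟨_, rfl⟩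
  rw [show (logTwoCosh (3 * u) - logTwoCosh u) / 2 = 2 * q by linarith] at hq_eq
  rw [show logTwoCosh (3 * u) - logTwoCosh u = 4 * q by linarith] at hlower
  rw [← hq] at hw
  have hq_pos : 0 < q := by
    rw [hq]
    linarith [strictMonoOn_logTwoCosh hu (show 0 < 3 * u by linarith) (by linarith)]
  have hconcave := sq_sub_sq_slope_lt_of_strictAntiOn deriv_logTwoCosh_pos
    strictAntiOn_sqGapSlope_logTwoCosh (show 0 < 2 * q by positivity)
    (show 2 * q < 2 * w by linarith) (show 2 * w < 2 * u by linarith)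
  have hm : 0 < logTwoCosh (2 * u) - logTwoCosh (2 * w) :=
    sub_pos.2 (strictMonoOn_logTwoCosh (show 0 < 2 * w by linarith)
      (show 0 < 2 * u by positivity) (by linarith))
  refine lt_of_mul_lt_mul_left ?_ (show 0 ≤ 2 * q by positivity)
  rw [hq_eq] at hconcave
  linear_combination hconcave + 2 * mul_lt_mul_of_pos_left hlower hm

theorem logTwoCosh_two_mul_add_lt {u k w : ℝ} (hu : 0 < u) (hk : 0 < k) (hkw : k ≤ w)
    (hw : k + w < u) (h : 2 * logTwoCosh u * k < u ^ 2 + k ^ 2 - w ^ 2) :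
    logTwoCosh (2 * w) + 2 * k < logTwoCosh (2 * u) := by
  have hlower := two_mul_sq_lt_logTwoCosh_mul hu
  have hq_eq := logTwoCosh_half_three_mul_sub u
  have hV := self_lt_logTwoCosh u
  set q := (logTwoCosh (3 * u) - logTwoCosh u) / 4 with hq
  rw [show (logTwoCosh (3 * u) - logTwoCosh u) / 2 = 2 * q by ring] at hq_eq
  have hkq : k < q := by
    refine lt_of_mul_lt_mul_left ?_ (hu.trans hV).le
    nlinarith
  rcases le_or_gt w q with hwq | hqw
  · have hmono := strictMonoOn_logTwoCosh.monotoneOn (show 0 < 2 * w by linarith)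
      (show 0 < 2 * q by linarith) (by linarith)
    linarith
  · have hdrop := four_mul_sq_sub_sq_lt_logTwoCosh_sub_mul hu hqw (by linarith)
    by_contra! hge
    nlinarith [mul_nonneg (show 0 ≤ 2 * k - (logTwoCosh (2 * u) - logTwoCosh (2 * w)) by linarith)
      (show 0 ≤ 4 * logTwoCosh u - 2 * k - (logTwoCosh (2 * u) - logTwoCosh (2 * w)) by linarith)]

theorem logTwoCosh_two_mul_mul_sqDslope_add_lt {u v : ℝ} (hu : 0 < u) (hv : 0 < v) :
    logTwoCosh (2 * (u * v * sqDslope logTwoCosh u v)) + 2 * (u ^ 2 * sqDslope logTwoCosh u v) <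
      logTwoCosh (2 * u) := by
  wlog huv : u ≤ v generalizing u v
  · have hswap := this hv hu (le_of_not_ge huv)
    have hchord := sqIntercept_comm (f := logTwoCosh) (add_pos hu hv).ne'
    have hmono := monotoneOn_logTwoCosh_two_mul_sub hv hu (le_of_not_ge huv)
    simp only [sqIntercept, sqDslope_comm logTwoCosh v u] at hchord hswap hmono
    rw [mul_comm v u] at hswap
    linarith
  have hD := sqDslope_pos deriv_logTwoCosh_pos hu hv
  have hsum := sqDslope_mul_add_lt_one deriv_logTwoCosh_pos (fun x _ => deriv_logTwoCosh_lt_one x)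
    hu hv
  have hsumV := sqDslope_logTwoCosh_mul_add_lt_one hu huv
  have hchord := sqDslope_mul_sq_sub_sq (f := logTwoCosh) (add_pos hu hv).ne'
  set D := sqDslope logTwoCosh u v
  have hDu : 0 < D * u := by positivity
  refine logTwoCosh_two_mul_add_lt hu (by positivity) ?_ (by nlinarith) ?_
  · nlinarith
  · have h : D * (2 * logTwoCosh u + D * (v ^ 2 - u ^ 2)) < 1 := by
      rw [hchord]
      linarith
    nlinarith [mul_lt_mul_of_pos_left h (sq_pos_of_pos hu)]

/-! ### The function `log (sinh x / x)` -/

theorem sinh_lt_mul_cosh {x : ℝ} (hx : 0 < x) : sinh x < x * cosh x := by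
  refine sub_pos.1 (pos_of_hasDerivAt_pos (f := fun y => y * cosh y - sinh y)
    (fun y => ((hasDerivAt_id' y).mul (hasDerivAt_cosh y)).sub (hasDerivAt_sinh y)) (by simp)
    (fun y hy => ?_) hx)
  have hsinh := sinh_pos_iff.2 hy
  linarith [mul_pos hy hsinh]

theorem three_mul_sinh_sq_lt {x : ℝ} (hx : 0 < x) :
    3 * sinh x ^ 2 < x ^ 2 + 2 * x * (cosh x * sinh x) := by
  have hderiv : ∀ y, HasDerivAt (fun y => y ^ 2 + 2 * y * (cosh y * sinh y) - 3 * sinh y ^ 2)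
      (4 * cosh y * (y * cosh y - sinh y)) y := fun y => by
    refine (((hasDerivAt_pow 2 y).add (((hasDerivAt_id' y).const_mul 2).mul
      ((hasDerivAt_cosh y).mul (hasDerivAt_sinh y)))).sub
      (((hasDerivAt_sinh y).pow 2).const_mul 3)).congr_deriv ?_
    simp only [Pi.mul_apply]
    push_cast
    linear_combination (-2 * y) * cosh_sq y
  refine sub_pos.1 (pos_of_hasDerivAt_pos hderiv (by simp) (fun y hy => ?_) hx)
  have hN := sub_pos.2 (sinh_lt_mul_cosh hy)
  positivity

/-- The Langevin function `coth x - 1 / x`. -/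
noncomputable def langevin (x : ℝ) : ℝ := cosh x / sinh x - 1 / x

theorem hasDerivAt_langevin {x : ℝ} (hx : x ≠ 0) :
    HasDerivAt langevin (1 - langevin x ^ 2 - 2 * langevin x / x) x := by
  have hs : sinh x ≠ 0 := sinh_ne_zero.2 hx
  refine (((hasDerivAt_cosh x).div (hasDerivAt_sinh x) hs).sub
    ((hasDerivAt_const x (1 : ℝ)).div (hasDerivAt_id' x) hx)).congr_deriv ?_
  rw [langevin]
  field_simp
  ring

theorem langevin_pos {x : ℝ} (hx : 0 < x) : 0 < langevin x := by
  rw [langevin, sub_pos, div_lt_div_iff₀ hx (sinh_pos_iff.2 hx), one_mul, mul_comm]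
  exact sinh_lt_mul_cosh hx

theorem langevin_lt_one {x : ℝ} (hx : 0 < x) : langevin x < 1 := by
  have hs := sinh_pos_iff.2 hx
  have hself : x < sinh x := self_lt_sinh_iff.2 hx
  have hexp : exp (-x) < 1 := exp_lt_one_iff.2 (neg_neg_of_pos hx)
  rw [langevin, sub_lt_iff_lt_add, div_lt_iff₀ hs, one_add_mul, one_div_mul_eq_div,
    ← sub_lt_iff_lt_add', cosh_sub_sinh, lt_div_iff₀ hx]
  nlinarith

theorem langevin_lt_tanh {x : ℝ} (hx : 0 < x) : langevin x < tanh x := by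
  have hs := sinh_pos_iff.2 hx
  have hself : x < sinh x * cosh x := by nlinarith [self_lt_sinh_iff.2 hx, one_le_cosh x]
  have h : tanh x - langevin x = 1 / x - 1 / (sinh x * cosh x) := by
    rw [tanh_eq_sinh_div_cosh, langevin]
    field_simp
    linear_combination (-x) * cosh_sq x
  rw [← sub_pos, h, sub_pos]
  exact one_div_lt_one_div_of_lt hx hself

theorem one_lt_langevin_sq_add {x : ℝ} (hx : 0 < x) : 1 < langevin x ^ 2 + 4 * langevin x / x := by
  have h : langevin x ^ 2 + 4 * langevin x / x - 1 =
      (x ^ 2 + 2 * x * (cosh x * sinh x) - 3 * sinh x ^ 2) / (x * sinh x) ^ 2 := by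
    rw [langevin]
    field_simp
    linear_combination x ^ 2 * cosh_sq x
  rw [← sub_pos, h]
  exact div_pos (sub_pos.2 (three_mul_sinh_sq_lt hx)) (by positivity)

theorem hasDerivAt_sinh_sq_mul_langevin_cubic {x : ℝ} (hx : x ≠ 0) :
    HasDerivAt (fun y => sinh y ^ 2 *
        (3 * langevin y - y + y * langevin y ^ 2 - langevin y ^ 3))
      (sinh x ^ 2 * langevin x ^ 2 * (langevin x ^ 2 + 4 * langevin x / x - 1)) x := by
  have hL := hasDerivAt_langevin hx
  have hcosh : cosh x = sinh x * (langevin x + 1 / x) := by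
    rw [langevin, sub_add_cancel, mul_div_cancel₀ _ (sinh_ne_zero.2 hx)]
  refine (((hasDerivAt_sinh x).pow 2).mul ((((hL.const_mul 3).sub (hasDerivAt_id' x)).add
    ((hasDerivAt_id' x).mul (hL.pow 2))).sub (hL.pow 3))).congr_deriv ?_
  rw [hcosh]
  simp only [Pi.pow_apply, Pi.sub_apply, Pi.add_apply, Pi.mul_apply]
  push_cast
  field_simp
  ring

theorem langevin_cubic_nonneg {x : ℝ} (hx : 0 < x) :
    0 ≤ 3 * langevin x - x + x * langevin x ^ 2 - langevin x ^ 3 := by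
  have hmono : MonotoneOn (fun y => sinh y ^ 2 *
      (3 * langevin y - y + y * langevin y ^ 2 - langevin y ^ 3)) (Ioi 0) :=
    monotoneOn_Ioi_of_hasDerivAt_nonneg
      (fun y hy => hasDerivAt_sinh_sq_mul_langevin_cubic hy.ne') fun y hy =>
        mul_nonneg (by positivity) (sub_nonneg.2 (one_lt_langevin_sq_add hy).le)
  have hlower : ∀ y, 0 < y → sinh y ^ 2 * (-y - 1) ≤ sinh y ^ 2 *
      (3 * langevin y - y + y * langevin y ^ 2 - langevin y ^ 3) := fun y hy => by
    have hL := langevin_pos hy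
    have hcube : langevin y ^ 3 ≤ 1 := pow_le_one₀ hL.le (langevin_lt_one hy).le
    have hsq : 0 ≤ y * langevin y ^ 2 := by positivity
    exact mul_le_mul_of_nonneg_left (by linarith) (sq_nonneg _)
  have hlim : Filter.Tendsto (fun y => sinh y ^ 2 * (-y - 1)) (nhdsWithin 0 (Ioi 0)) (nhds 0) :=
    tendsto_nhdsWithin_of_tendsto_nhds <| Continuous.tendsto' (by fun_prop) _ _ (by simp)
  exact nonneg_of_mul_nonneg_right
    (nonneg_of_monotoneOn_of_le_of_tendsto hmono hlower hlim hx) (by positivity)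

/-- The logarithm of `sinh x / x`. Its value at `0` is the limit `0`, since `0 / 0 = 0` and
`log 0 = 0`. -/
noncomputable def logSinhc (x : ℝ) : ℝ := log (sinh x / x)

theorem exp_logSinhc {x : ℝ} (hx : x ≠ 0) : exp (logSinhc x) = sinh x / x := by
  refine exp_log ?_
  rcases hx.lt_or_gt with h | h
  · exact div_pos_of_neg_of_neg (sinh_neg_iff.2 h) h
  · exact div_pos (sinh_pos_iff.2 h) h

theorem logSinhc_zero : logSinhc 0 = 0 := by simp [logSinhc]

theorem even_logSinhc : Function.Even logSinhc := fun x => by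
  rw [logSinhc, logSinhc, sinh_neg, neg_div_neg_eq]

theorem hasDerivAt_logSinhc {x : ℝ} (hx : x ≠ 0) : HasDerivAt logSinhc (langevin x) x := by
  have hs : sinh x ≠ 0 := sinh_ne_zero.2 hx
  refine (((hasDerivAt_sinh x).div (hasDerivAt_id' x) hx).log (div_ne_zero hs hx)).congr_deriv ?_
  rw [langevin, Pi.div_apply]
  field_simp

theorem deriv_logSinhc {x : ℝ} (hx : x ≠ 0) : deriv logSinhc x = langevin x :=
  (hasDerivAt_logSinhc hx).deriv

theorem deriv_logSinhc_pos (x : ℝ) (hx : 0 < x) : 0 < deriv logSinhc x :=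
  deriv_logSinhc hx.ne' ▸ langevin_pos hx

theorem deriv_logSinhc_lt_one (x : ℝ) (hx : 0 < x) : deriv logSinhc x < 1 :=
  deriv_logSinhc hx.ne' ▸ langevin_lt_one hx

theorem monotoneOn_sqGapSlope_logSinhc : MonotoneOn (sqGapSlope logSinhc) (Ioi 0) := by
  have hderiv : ∀ x, 0 < x → HasDerivAt (fun y => 2 * y / langevin y - 2 * logSinhc y)
      (2 * (3 * langevin x - x + x * langevin x ^ 2 - langevin x ^ 3) / langevin x ^ 2) x :=
    fun x hx => by
      have hL := (langevin_pos hx).ne'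
      refine ((((hasDerivAt_id' x).const_mul 2).div (hasDerivAt_langevin hx.ne') hL).sub
        ((hasDerivAt_logSinhc hx.ne').const_mul 2)).congr_deriv ?_
      field_simp
      ring
  refine (monotoneOn_Ioi_of_hasDerivAt_nonneg hderiv fun x hx => ?_).congr fun x hx => ?_
  · have hcubic := langevin_cubic_nonneg hx
    positivity
  · rw [sqGapSlope, deriv_logSinhc (ne_of_gt hx)]

theorem strictMonoOn_logTwoCosh_sub_logSinhc :
    StrictMonoOn (fun x => logTwoCosh x - logSinhc x) (Ioi 0) :=
  strictMonoOn_Ioi_of_hasDerivAt_pos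
    (fun x hx => (hasDerivAt_logTwoCosh x).sub (hasDerivAt_logSinhc hx.ne'))
    fun _ hx => sub_pos.2 (langevin_lt_tanh hx)

theorem logTwoCosh_mul_mul_sqDslope_logSinhc_add_lt {u v : ℝ} (hu : 0 < u) (hv : 0 < v) :
    logTwoCosh (u * v * sqDslope logSinhc u v) + u ^ 2 * sqDslope logSinhc u v < logTwoCosh u := by
  have hD := sqDslope_pos deriv_logSinhc_pos hu hv
  have hwu := mul_mul_sqDslope_lt deriv_logSinhc_pos deriv_logSinhc_lt_one hu hv
  have hF := le_sqIntercept_of_monotoneOn deriv_logSinhc_pos deriv_logSinhc_lt_one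
    monotoneOn_sqGapSlope_logSinhc hu hv
  have hVF := strictMonoOn_logTwoCosh_sub_logSinhc
    (show 0 < u * v * sqDslope logSinhc u v by positivity) hu hwu
  rw [sqIntercept] at hF
  linarith

/-! ### The means in logarithmic coordinates -/

theorem exp_add_add_exp_sub (g u : ℝ) : exp (g + u) + exp (g - u) = exp (g + logTwoCosh u) := by
  rw [exp_add g (logTwoCosh u), exp_logTwoCosh, cosh_eq, exp_add, sub_eq_add_neg, exp_add]
  ring

theorem exp_add_sub_exp_sub {u : ℝ} (g : ℝ) (hu : u ≠ 0) :
    exp (g + u) - exp (g - u) = 2 * u * exp (g + logSinhc u) := by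
  rw [exp_add g (logSinhc u), exp_logSinhc hu, sinh_eq, exp_add, sub_eq_add_neg g u, exp_add]
  field_simp

theorem exp_add_rpow (g u r : ℝ) : exp (g + u) ^ r = exp (g * r + r * u) := by
  rw [← exp_mul, add_mul, mul_comm u]

theorem exp_sub_rpow (g u r : ℝ) : exp (g - u) ^ r = exp (g * r - r * u) := by
  rw [← exp_mul, sub_mul, mul_comm u]

theorem sub_one_mul_mul_dslope (f : ℝ → ℝ) (r u : ℝ) :
    (r - 1) * (u * dslope f u (r * u)) = f (r * u) - f u := by
  rw [← sub_smul_dslope f u (r * u), smul_eq_mul]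
  ring

theorem genInvHarmMean_exp (r g u : ℝ) :
    genInvHarmMean r (exp (g - u)) (exp (g + u)) =
      exp (g + u * dslope logTwoCosh u (r * u)) := by
  unfold genInvHarmMean
  split_ifs with hr
  · have hsum : exp (g + u) + exp (g - u) ≠ 0 := by positivity
    have hsub : exp (g + u) - exp (g - u) = (exp (g + u) + exp (g - u)) * tanh u := by
      rw [tanh_eq, exp_add, sub_eq_add_neg g u, exp_add]
      field_simp
    rw [hr, one_mul, dslope_same, deriv_logTwoCosh, ← exp_mul, ← exp_mul, ← exp_add, ← exp_mul,
      mul_one_div, exp_eq_exp, div_eq_iff hsum]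
    linear_combination u * hsub
  · rw [exp_add_rpow, exp_sub_rpow, exp_add_add_exp_sub, exp_add_add_exp_sub, ← exp_sub,
      ← exp_mul, mul_one_div, exp_eq_exp, div_eq_iff (sub_ne_zero.2 hr)]
    linear_combination -sub_one_mul_mul_dslope logTwoCosh r u

theorem genLogMean_exp (r g u : ℝ) :
    genLogMean r (exp (g - u)) (exp (g + u)) = exp (g + u * dslope logSinhc u (r * u)) := by
  unfold genLogMean
  obtain rfl | hu := eq_or_ne u 0
  · rw [sub_zero, add_zero, if_pos rfl, zero_mul, add_zero]
  have hne : exp (g - u) ≠ exp (g + u) := fun h => hu (by linarith [exp_injective h])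
  have hsub := exp_add_sub_exp_sub g hu
  rw [if_neg hne]
  split_ifs with hr_zero hr_one
  · have hslope := sub_one_mul_mul_dslope logSinhc r u
    rw [hr_zero, zero_mul, logSinhc_zero] at hslope
    rw [hsub, log_exp, log_exp, hr_zero, zero_mul, add_sub_sub_cancel, ← two_mul,
      mul_div_cancel_left₀ _ (by simpa using hu), exp_eq_exp]
    linear_combination hslope
  · have hs := sinh_ne_zero.2 hu
    have hadd : u * (exp (g + u) + exp (g - u)) =
        (exp (g + u) - exp (g - u)) * (1 + u * langevin u) := by
      have hcoth : u * cosh u = sinh u * (1 + u * langevin u) := by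
        rw [langevin]
        field_simp
        ring
      rw [cosh_eq, sinh_eq] at hcoth
      rw [exp_add, sub_eq_add_neg g u, exp_add]
      linear_combination 2 * exp g * hcoth
    rw [hr_one, one_mul, dslope_same, deriv_logSinhc hu, ← exp_mul, ← exp_mul, ← exp_sub, ← exp_mul,
      one_div, ← exp_neg, ← exp_add, mul_one_div, exp_eq_exp, neg_add_eq_iff_eq_add,
      div_eq_iff (sub_ne_zero.2 hne.symm)]
    linear_combination hadd
  · rw [exp_add_rpow, exp_sub_rpow, exp_add_sub_exp_sub _ (mul_ne_zero hr_zero hu), hsub,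
      ← mul_assoc r, mul_left_comm r 2 u, mul_div_mul_left _ _ (by positivity), ← exp_sub,
      ← exp_mul, mul_one_div, exp_eq_exp, div_eq_iff (sub_ne_zero.2 hr_one)]
    linear_combination -sub_one_mul_mul_dslope logSinhc r u

theorem exists_exp_sub_exp_add {a b : ℝ} (ha : 0 < a) (hb : 0 < b) :
    ∃ g u, exp (g - u) = a ∧ exp (g + u) = b := by
  refine ⟨(log a + log b) / 2, (log b - log a) / 2, ?_, ?_⟩
  · rw [← exp_log ha, log_exp]
    ring_nf
  · rw [← exp_log hb, log_exp]
    ring_nf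

theorem exists_pos_exp_sub_exp_add {a b : ℝ} (ha : 0 < a) (hab : a < b) :
    ∃ g u, 0 < u ∧ exp (g - u) = a ∧ exp (g + u) = b := by
  obtain ⟨g, u, rfl, rfl⟩ := exists_exp_sub_exp_add ha (ha.trans hab)
  exact ⟨g, u, by linarith [exp_lt_exp.1 hab], rfl, rfl⟩

theorem exp_add_mul_dslope_mem_Icc {f : ℝ → ℝ} {u v : ℝ} (hpos : ∀ x, 0 < x → 0 < deriv f x)
    (hlt : ∀ x, 0 < x → deriv f x < 1) (hu : 0 < u) (hv : 0 < v) (g : ℝ) :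
    exp (g + u * dslope f u v) ∈ Icc (exp (g - u)) (exp (g + u)) := by
  have hD := sqDslope_pos hpos hu hv
  rw [dslope_eq_sqDslope_mul (by positivity)]
  refine ⟨exp_le_exp.2 ?_, exp_le_exp.2 ?_⟩
  · have h : 0 ≤ u * (sqDslope f u v * (u + v)) := by positivity
    linarith
  · gcongr
    exact mul_le_of_le_one_right hu.le (sqDslope_mul_add_lt_one hpos hlt hu hv).le

theorem mul_dslope_eq_add {f : ℝ → ℝ} {u v : ℝ} (h : u + v ≠ 0) :
    u * dslope f u v = u ^ 2 * sqDslope f u v + u * v * sqDslope f u v := by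
  rw [dslope_eq_sqDslope_mul h]
  ring

theorem mul_dslope_neg_eq_sub {f : ℝ → ℝ} {u v : ℝ} (hf : Function.Even f) (hu : 0 < u)
    (hv : 0 < v) :
    u * dslope f u (-v) = u ^ 2 * sqDslope f u v - u * v * sqDslope f u v := by
  rw [dslope_neg_eq_sqDslope_mul hf hu hv]
  ring

section Means

variable {r a b : ℝ}

theorem genInvHarmMean_pos (r : ℝ) (ha : 0 < a) (hb : 0 < b) : 0 < genInvHarmMean r a b := by
  obtain ⟨g, u, rfl, rfl⟩ := exists_exp_sub_exp_add ha hb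
  exact genInvHarmMean_exp r g u ▸ exp_pos _

theorem genLogMean_pos (r : ℝ) (ha : 0 < a) (hb : 0 < b) : 0 < genLogMean r a b := by
  obtain ⟨g, u, rfl, rfl⟩ := exists_exp_sub_exp_add ha hb
  exact genLogMean_exp r g u ▸ exp_pos _

theorem genInvHarmMean_mem_Icc (hr : 0 < r) (ha : 0 < a) (hab : a < b) :
    genInvHarmMean r a b ∈ Icc a b := by
  obtain ⟨g, u, hu, rfl, rfl⟩ := exists_pos_exp_sub_exp_add ha hab
  rw [genInvHarmMean_exp]
  exact exp_add_mul_dslope_mem_Icc deriv_logTwoCosh_pos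
    (fun x _ => deriv_logTwoCosh_lt_one x) hu (mul_pos hr hu) g

theorem genLogMean_mem_Icc (hr : 0 < r) (ha : 0 < a) (hab : a < b) :
    genLogMean r a b ∈ Icc a b := by
  obtain ⟨g, u, hu, rfl, rfl⟩ := exists_pos_exp_sub_exp_add ha hab
  rw [genLogMean_exp]
  exact exp_add_mul_dslope_mem_Icc deriv_logSinhc_pos deriv_logSinhc_lt_one hu (mul_pos hr hu) g

theorem add_lt_genInvHarmMean_add_neg (hr : 0 < r) (ha : 0 < a) (hab : a < b) :
    a + b < genInvHarmMean r a b + genInvHarmMean (-r) a b := by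
  obtain ⟨g, u, hu, rfl, rfl⟩ := exists_pos_exp_sub_exp_add ha hab
  have hv : 0 < r * u := mul_pos hr hu
  have hV := sqIntercept_lt_of_strictAntiOn deriv_logTwoCosh_pos
    (fun x _ => deriv_logTwoCosh_lt_one x) strictAntiOn_sqGapSlope_logTwoCosh hu hv
  rw [sqIntercept] at hV
  rw [genInvHarmMean_exp, genInvHarmMean_exp, neg_mul, mul_dslope_eq_add (by positivity),
    mul_dslope_neg_eq_sub even_logTwoCosh hu hv, ← add_assoc, ← add_sub_assoc,
    add_comm (exp (g - u)), exp_add_add_exp_sub, exp_add_add_exp_sub, exp_lt_exp]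
  linarith

theorem genInvHarmMean_sq_add_neg_sq_lt (hr : 0 < r) (ha : 0 < a) (hab : a < b) :
    genInvHarmMean r a b ^ 2 + genInvHarmMean (-r) a b ^ 2 < a ^ 2 + b ^ 2 := by
  obtain ⟨g, u, hu, rfl, rfl⟩ := exists_pos_exp_sub_exp_add ha hab
  have hv : 0 < r * u := mul_pos hr hu
  have hV := logTwoCosh_two_mul_mul_sqDslope_add_lt hu hv
  rw [genInvHarmMean_exp, genInvHarmMean_exp, neg_mul, mul_dslope_eq_add (by positivity),
    mul_dslope_neg_eq_sub even_logTwoCosh hu hv, add_comm (exp (g - u) ^ 2)]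
  simp only [← exp_nat_mul, Nat.cast_ofNat, mul_add (2 : ℝ), mul_sub (2 : ℝ), ← add_assoc,
    ← add_sub_assoc]
  rw [exp_add_add_exp_sub, exp_add_add_exp_sub, exp_lt_exp]
  linarith

theorem genLogMean_add_neg_lt (hr : 0 < r) (ha : 0 < a) (hab : a < b) :
    genLogMean r a b + genLogMean (-r) a b < a + b := by
  obtain ⟨g, u, hu, rfl, rfl⟩ := exists_pos_exp_sub_exp_add ha hab
  have hv : 0 < r * u := mul_pos hr hu
  have hF := logTwoCosh_mul_mul_sqDslope_logSinhc_add_lt hu hv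
  rw [genLogMean_exp, genLogMean_exp, neg_mul, mul_dslope_eq_add (by positivity),
    mul_dslope_neg_eq_sub even_logSinhc hu hv, ← add_assoc, ← add_sub_assoc,
    add_comm (exp (g - u)), exp_add_add_exp_sub, exp_add_add_exp_sub, exp_lt_exp]
  linarith

end Means

theorem corollary6p3 (r a b : ℝ) (hr : 0 < r) (ha : 0 < a) (hab : a < b) :
    (∀ α : ℝ, 0 < α → α ≤ 1 →
      genInvHarmMean r a b ^ α + genInvHarmMean (-r) a b ^ α > a ^ α + b ^ α) ∧
    (∀ β : ℝ, 0 ≤ β →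
      genInvHarmMean r a b ^ (2 + β) + genInvHarmMean (-r) a b ^ (2 + β)
        < a ^ (2 + β) + b ^ (2 + β)) ∧
    (∀ β : ℝ, 0 ≤ β →
      genLogMean r a b ^ (1 + β) + genLogMean (-r) a b ^ (1 + β)
        < a ^ (1 + β) + b ^ (1 + β)) := by
  have hC := genInvHarmMean_mem_Icc hr ha hab
  refine ⟨fun α hα hα_one => ?_, fun β hβ => ?_, fun β hβ => ?_⟩
  · exact rpow_add_rpow_lt_of_le_one ha.le hC hα hα_one
      (add_lt_genInvHarmMean_add_neg hr ha hab)
  · refine rpow_add_rpow_lt_of_rpow_add_rpow_lt ha.le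
      (genInvHarmMean_pos (-r) ha (ha.trans hab)).le hC two_pos (le_add_of_nonneg_right hβ) ?_
    simpa only [rpow_two] using genInvHarmMean_sq_add_neg_sq_lt hr ha hab
  · refine rpow_add_rpow_lt_of_rpow_add_rpow_lt ha.le
      (genLogMean_pos (-r) ha (ha.trans hab)).le (genLogMean_mem_Icc hr ha hab)
      one_pos (le_add_of_nonneg_right hβ) ?_
    simpa only [rpow_one] using genLogMean_add_neg_lt hr ha hab
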